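/- **Local equivariant curves.** Let $G$ be a finite group acting freely on a finite set $I$, and let $\bar I \subset I$ be a system of representatives of the orbits. Let $\chi,\upsilon,\beta\colon G\to\mathbb{C}^\times$ be characters with $\beta^2=1$, and let $\sqrt\chi\colon G\to\mathbb{C}^\times$ be a function with $(\sqrt\chi)_\gamma^2=\chi_\gamma$ for all $\gamma$ and $(\sqrt\chi)_e=1$. A *local $G$-equivariant spectral curve* $\mathcal{S}_G$ with these data is the formal curve $\bigsqcup_{i\in I}\operatorname{Spec}\mathbb{C}[[\zeta_i]]$ together with $$x(\zeta_i)=\zeta_i^2+\alpha_i,\qquad y(\zeta_i)=\sum_{k\ge0}h^i_k\zeta_i^k ,$$ $$B(\zeta_{i,1},\zeta_{j,2})=\frac{\sum_{\gamma\in G}\beta_\gamma\delta_{i,\gamma j}}{|G|}\,\frac{dt_{i,1}\,dt_{j,2}}{(t_{i,1}-t_{j,2})^2}+\sum_{k,l\ge0}B^{i,j}_{k,l}\,\zeta_{i,1}^k\zeta_{j,2}^l\,d\zeta_{i,1}d\zeta_{j,2},$$ where $t_{\gamma i}=\zeta_{\gamma i}/(\sqrt\chi)_\gamma$ for $i\in\bar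 I$, $\gamma\in G$. The coefficients satisfy, for $i,j\in\bar I$ and $\gamma,\eta\in G$, $$h^{\gamma i}_k=\upsilon_\gamma(\sqrt\chi)_\gamma^{-k}h^i_k,\qquad B^{\gamma i,\eta j}_{k,l}=B^{\eta j,\gamma i}_{l,k}=\beta_{\gamma\eta}(\sqrt\chi)_\gamma^{-k-1}(\sqrt\chi)_\eta^{-l-1}B^{i,j}_{k,l}.$$ We assume that $y(\zeta_i)\neq y(-\zeta_i)$ for every $i\in I$ (for example, that $h^i_1\ne0$), so that the recursion kernel below is defined. **Topological recursion.** The correlators $\omega_{g,n+1}$, for $g,n\ge0$ and $2g-2+(n+1)>0$, are formal meromorphic multidifferentials with poles only where some coordinate vanishes. They are defined by $\omega_{0,2}=B$ and recursively by $$\omega_{g,n+1}(\zeta_0,\dots,\zeta_n)=\sum_{i\in I}\operatorname*{Res}_{\zeta_i\to0}K(\zeta_0,\zeta_i)\Big(\omega_{g-1,n+2}(\zeta_i,-\zeta_i,\zeta_1,\dots,\zeta_n)+\sum_{\substack{g_1+g_2=g\\ J_1\sqcup J_2=\{1,\dots,n\}}}^{\text{no }(0,1)}\omega_{g_1,1+|J_1|}(\zeta_i,\zeta_{J_1})\,\omega_{g_2,1+|J_2|}(-\zeta_i,\zeta_{J_2})\Big),$$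 $$K(\zeta_0,\zeta_i)=\frac{\frac12\int_{-\zeta_i}^{\zeta_i}B(\zeta_0,\cdot)}{\big(y(\zeta_i)-y(-\zeta_i)\big)\,dx(\zeta_i)} .$$ Here the term with $\omega_{g-1,n+2}$ is absent for $g=0$, the terms containing $\omega_{0,1}$ are omitted, and the residue is taken with $\zeta_i$ small compared to $\zeta_0,\dots,\zeta_n$. **Quotient.** The quotient (reduced) curve $\mathcal{S}_{\mathrm{red}}$ is $\bigsqcup_{i\in\bar I}\operatorname{Spec}\mathbb{C}[[\zeta_i]]$ with $x$, $y$, $B$ restricted to it. The reduced correlators $\omega^{\mathrm{red}}_{g,n}$ are obtained from it by the same recursion, with the sum over $i\in\bar I$. They are extended to all components $i\in I$ by $$\omega^{\mathrm{red}}_{g,n}(\dots,\zeta_{\gamma i},\dots)=\beta_\gamma\,\omega^{\mathrm{red}}_{g,n}(\dots,\zeta_i,\dots)\qquad(i\in\bar I,\ \gamma\in G)$$ in each variable, under the substitution $\zeta_{\gamma i}=(\sqrt\chi)_\gamma\zeta_i$. **Proposition.** Let $\mathcal{S}_G$ be a local $G$-equivariant spectral curve, and let $g\ge0$, $n\ge1$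 with $2g-2+n>0$. If $\chi\cdot\upsilon\neq\beta$, then $\omega_{g,n}=0$. If $\chi\cdot\upsilon=\beta$, then $$\omega_{g,n}=|G|^{2g-2+n}\,\omega^{\mathrm{red}}_{g,n},$$ where $\omega^{\mathrm{red}}_{g,n}$ is the extended reduced correlator. -/

import Mathlib

/-! Topological recursion on formal local spectral curves
`⨆ᵢ Spec ℂ⟦ζᵢ⟧`, with and without the action of a finite group. -/

namespace LocalTR

noncomputable section

/-! ### Laurent series in the residue variable -/

/-- `f` vanishes to order at least `N`. -/
def VanishBelow (f : LaurentSeries ℂ) (N : ℤ) : Prop := ∀ p < N, f.coeff p = 0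

theorem VanishBelow.mono {f : LaurentSeries ℂ} {a b : ℤ} (hf : VanishBelow f a) (h : b ≤ a) :
    VanishBelow f b := fun p hp => hf p (lt_of_lt_of_le hp h)

theorem VanishBelow.zero (N : ℤ) : VanishBelow 0 N := fun _ _ => rfl

theorem VanishBelow.add {f g : LaurentSeries ℂ} {a : ℤ} (hf : VanishBelow f a)
    (hg : VanishBelow g a) : VanishBelow (f + g) a := fun p hp => by
  simp [hf p hp, hg p hp]

theorem VanishBelow.neg {f : LaurentSeries ℂ} {a : ℤ} (hf : VanishBelow f a) :
    VanishBelow (-f) a := fun p hp => by simp [hf p hp]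

theorem VanishBelow.sum {ι : Type*} {s : Finset ι} {f : ι → LaurentSeries ℂ} {a : ℤ}
    (hf : ∀ x ∈ s, VanishBelow (f x) a) : VanishBelow (∑ x ∈ s, f x) a :=
  Finset.sum_induction f (fun g => VanishBelow g a) (fun _ _ => VanishBelow.add)
    (VanishBelow.zero a) hf

theorem VanishBelow.mul {f g : LaurentSeries ℂ} {a b : ℤ} (hf : VanishBelow f a)
    (hg : VanishBelow g b) : VanishBelow (f * g) (a + b) := fun p hp => by
  rw [HahnSeries.coeff_mul]
  refine Finset.sum_eq_zero fun x hx => ?_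
  rw [Finset.mem_antidiagonal] at hx
  rcases lt_or_ge x.1 a with h | h
  · rw [hf _ h, zero_mul]
  · rw [hg x.2 (by omega), mul_zero]

theorem exists_vanishBelow (f : LaurentSeries ℂ) : ∃ N, VanishBelow f N :=
  ⟨f.order, fun _ hp => HahnSeries.coeff_eq_zero_of_lt_order hp⟩

theorem vanishBelow_ofPowerSeries {f : PowerSeries ℂ} {N : ℕ}
    (hf : ∀ k < N, PowerSeries.coeff k f = 0) :
    VanishBelow (HahnSeries.ofPowerSeries ℤ ℂ f) N := fun p hp => by
  rcases lt_or_ge p 0 with h | h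
  · rw [HahnSeries.ofPowerSeries_apply]
    refine HahnSeries.embDomain_of_notMem_range ?_
    rintro ⟨k, rfl⟩
    simp at h
    omega
  · lift p to ℕ using h
    rw [HahnSeries.ofPowerSeries_apply_coeff]
    exact hf p (by exact_mod_cast hp)

/-- The Laurent series `f(-ζ)`. -/
def negArg (f : LaurentSeries ℂ) : LaurentSeries ℂ where
  coeff p := (-1) ^ p * f.coeff p
  isPWO_support' := f.isPWO_support.mono fun p hp h => hp (by simp [h])

theorem VanishBelow.negArg {f : LaurentSeries ℂ} {a : ℤ} (hf : VanishBelow f a) :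
    VanishBelow (negArg f) a := fun p hp => by simp [LocalTR.negArg, hf p hp]

/-- `∫_{-ζ}^{ζ} f(w) dw = F(ζ) - F(-ζ)` for the formal primitive `F` of `f`. -/
def symIntegral (f : PowerSeries ℂ) : PowerSeries ℂ :=
  let F : PowerSeries ℂ :=
    PowerSeries.mk fun k => if k = 0 then 0 else PowerSeries.coeff (k - 1) f / k
  F - PowerSeries.rescale (-1) F

/-! ### Multidifferentials -/

/-- A formal meromorphic `n`-differential on `(⨆ᵢ Spec ℂ⟦ζᵢ⟧)ⁿ` with poles only along the loci
where one of the coordinates vanishes.  On the component `(i₁, …, iₙ)` it is `f dζ₁ ⋯ dζₙ` with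
`f ∈ ℂ⟦ζ₁, …, ζₙ⟧[ζ₁⁻¹, …, ζₙ⁻¹]`, and `coeff ((i₁, m₁), …, (iₙ, mₙ))` is the coefficient of
`ζ₁^m₁ ⋯ ζₙ^mₙ` in `f`.  The condition `bdd` says that the orders of the poles are bounded. -/
@[ext]
structure MultiDiff (I : Type*) (n : ℕ) where
  coeff : (Fin n → I × ℤ) → ℂ
  bdd : ∃ N : ℤ, ∀ v, (∃ j, (v j).2 < N) → coeff v = 0

instance {I : Type*} {n : ℕ} : Zero (MultiDiff I n) := ⟨⟨fun _ => 0, 0, fun _ _ => rfl⟩⟩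

namespace MultiDiff

variable {I : Type*} {n : ℕ}

/-- The Laurent series `∑ₚ ω((i, p), v) ζ^p`: the part of `ω(ζᵢ, ζ₁, …, ζₙ) / dζᵢ` with
monomial `v` in the remaining variables. -/
def series (ω : MultiDiff I (n + 1)) (i : I) (v : Fin n → I × ℤ) : LaurentSeries ℂ :=
  HahnSeries.ofSuppBddBelow (fun p : ℤ => ω.coeff (Fin.cons (i, p) v)) (by
    obtain ⟨N, hN⟩ := ω.bdd
    refine ⟨N, fun p hp => ?_⟩
    by_contra h
    exact hp (hN _ ⟨0, by simpa using h⟩))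

/-- The part of `ω(ζᵢ, -ζᵢ, ζ₁, …, ζₙ) / (dζᵢ)²` with monomial `v` in the remaining variables.
The sign is that of `(-ζ)^q d(-ζ) = (-1)^(q+1) ζ^q dζ`.  The sum has finite support. -/
def diag (ω : MultiDiff I (n + 2)) (i : I) (v : Fin n → I × ℤ) : LaurentSeries ℂ :=
  HahnSeries.ofSuppBddBelow
    (fun m : ℤ => ∑ᶠ p : ℤ, (-1) ^ (m - p + 1) *
      ω.coeff (Fin.cons (i, p) (Fin.cons (i, m - p) v : Fin (n + 1) → I × ℤ))) (by
    obtain ⟨N, hN⟩ := ω.bdd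
    refine ⟨2 * N, fun m hm => ?_⟩
    by_contra h
    refine hm (finsum_eq_zero_of_forall_eq_zero fun p => ?_)
    rcases lt_or_ge p N with hp | hp
    · rw [hN _ ⟨0, by simpa using hp⟩, mul_zero]
    · rw [hN _ ⟨1, ?_⟩, mul_zero]
      change (m - p) < N
      omega)

end MultiDiff

/-- A family of Laurent series in the residue variable, indexed by the monomials in the remaining
variables, such that only boundedly negative powers contribute to each order. -/
structure Tame {I : Type*} {n : ℕ} (F : (Fin n → I × ℤ) → LaurentSeries ℂ) : Prop where
  order : ∃ N, ∀ v, VanishBelow (F v) N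
  escape : ∀ M : ℤ, ∃ N : ℤ, ∀ v, (∃ j, (v j).2 < N) → VanishBelow (F v) M

namespace Tame

variable {I : Type*} {n : ℕ}

theorem zero : Tame (fun _ : Fin n → I × ℤ => (0 : LaurentSeries ℂ)) :=
  ⟨⟨0, fun _ => .zero 0⟩, fun M => ⟨0, fun _ _ => .zero M⟩⟩

theorem const (f : LaurentSeries ℂ) : Tame (fun _ : Fin 0 → I × ℤ => f) := by
  obtain ⟨N, hN⟩ := exists_vanishBelow f
  exact ⟨⟨N, fun _ => hN⟩, fun M => ⟨0, fun _ ⟨j, _⟩ => j.elim0⟩⟩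

theorem add {F F' : (Fin n → I × ℤ) → LaurentSeries ℂ} (hF : Tame F) (hF' : Tame F') :
    Tame (fun v => F v + F' v) := by
  obtain ⟨a, ha⟩ := hF.order
  obtain ⟨b, hb⟩ := hF'.order
  refine ⟨⟨min a b, fun v => ((ha v).mono (min_le_left _ _)).add
    ((hb v).mono (min_le_right _ _))⟩, fun M => ?_⟩
  obtain ⟨a, ha⟩ := hF.escape M
  obtain ⟨b, hb⟩ := hF'.escape M
  exact ⟨min a b, fun v ⟨j, hj⟩ => (ha v ⟨j, lt_of_lt_of_le hj (min_le_left _ _)⟩).add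
    (hb v ⟨j, lt_of_lt_of_le hj (min_le_right _ _)⟩)⟩

theorem sum {ι : Type*} (s : Finset ι) {F : ι → (Fin n → I × ℤ) → LaurentSeries ℂ}
    (hF : ∀ x, Tame (F x)) : Tame (fun v => ∑ x ∈ s, F x v) := by
  classical
  induction s using Finset.induction_on with
  | empty => simpa using zero
  | insert a s ha ih => simpa [Finset.sum_insert ha] using (hF a).add ih

theorem neg {F : (Fin n → I × ℤ) → LaurentSeries ℂ} (hF : Tame F) : Tame (fun v => -F v) := by
  obtain ⟨a, ha⟩ := hF.order
  refine ⟨⟨a, fun v => (ha v).neg⟩, fun M => ?_⟩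
  obtain ⟨b, hb⟩ := hF.escape M
  exact ⟨b, fun v hv => (hb v hv).neg⟩

theorem negArg {F : (Fin n → I × ℤ) → LaurentSeries ℂ} (hF : Tame F) :
    Tame (fun v => negArg (F v)) := by
  obtain ⟨a, ha⟩ := hF.order
  refine ⟨⟨a, fun v => (ha v).negArg⟩, fun M => ?_⟩
  obtain ⟨b, hb⟩ := hF.escape M
  exact ⟨b, fun v hv => (hb v hv).negArg⟩

/-- Products over complementary sets of variables. -/
theorem mul {m l : ℕ} {F : (Fin m → I × ℤ) → LaurentSeries ℂ}
    {F' : (Fin l → I × ℤ) → LaurentSeries ℂ} (hF : Tame F) (hF' : Tame F')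
    (e : Fin m → Fin n) (e' : Fin l → Fin n) (he : ∀ j, (∃ a, e a = j) ∨ ∃ a, e' a = j) :
    Tame (fun v : Fin n → I × ℤ => F (v ∘ e) * F' (v ∘ e')) := by
  obtain ⟨a, ha⟩ := hF.order
  obtain ⟨b, hb⟩ := hF'.order
  refine ⟨⟨a + b, fun v => (ha _).mul (hb _)⟩, fun M => ?_⟩
  obtain ⟨a', ha'⟩ := hF.escape (M - b)
  obtain ⟨b', hb'⟩ := hF'.escape (M - a)
  refine ⟨min a' b', fun v ⟨j, hj⟩ => ?_⟩
  rcases he j with ⟨x, rfl⟩ | ⟨x, rfl⟩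
  · exact ((ha' (v ∘ e) ⟨x, lt_of_lt_of_le hj (min_le_left _ _)⟩).mul (hb _)).mono (by omega)
  · exact ((ha _).mul (hb' (v ∘ e') ⟨x, lt_of_lt_of_le hj (min_le_right _ _)⟩)).mono (by omega)

theorem series (ω : MultiDiff I (n + 1)) (i : I) : Tame (ω.series i) := by
  obtain ⟨N, hN⟩ := ω.bdd
  refine ⟨⟨N, fun v p hp => hN _ ⟨0, by simpa using hp⟩⟩,
    fun M => ⟨N, fun v ⟨j, hj⟩ p _ => hN _ ⟨j.succ, by simpa using hj⟩⟩⟩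

theorem diag (ω : MultiDiff I (n + 2)) (i : I) : Tame (ω.diag i) := by
  obtain ⟨N, hN⟩ := ω.bdd
  refine ⟨⟨2 * N, fun v m hm => finsum_eq_zero_of_forall_eq_zero fun p => ?_⟩,
    fun M => ⟨N, fun v ⟨j, hj⟩ m _ => finsum_eq_zero_of_forall_eq_zero fun p => ?_⟩⟩
  · rcases lt_or_ge p N with hp | hp
    · rw [hN _ ⟨0, by simpa using hp⟩, mul_zero]
    · rw [hN _ ⟨1, ?_⟩, mul_zero]
      change (m - p) < N
      omega
  · rw [hN _ ⟨j.succ.succ, by simpa using hj⟩, mul_zero]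

end Tame

/-! ### Local spectral curves and topological recursion -/

/-- A local spectral curve `⨆ᵢ Spec ℂ⟦ζᵢ⟧` with

* `x(ζᵢ) = ζᵢ² + αᵢ`,
* `y(ζᵢ) = ∑ₖ hᵢₖ ζᵢᵏ`,
* `B(ζᵢ, ζⱼ) = cᵢⱼ dtᵢ dtⱼ / (tᵢ - tⱼ)² + ∑ₖₗ Bᵢⱼₖₗ ζᵢᵏ ζⱼˡ dζᵢ dζⱼ`, symmetric, where `tᵢ = ζᵢ / τᵢ`.

The usual local spectral curves have `τ = 1` and `c` a multiple of the identity matrix; in general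
`B` has double poles also between different components. -/
structure Curve (I : Type*) where
  α : I → ℂ
  h : I → ℕ → ℂ
  τ : I → ℂˣ
  c : I → I → ℂ
  jump : I → I → ℕ → ℕ → ℂ
  c_symm : ∀ i j, c i j = c j i
  jump_symm : ∀ i j k l, jump i j k l = jump j i l k

namespace Curve

variable {I : Type*} (S : Curve I)

/-- `x` on the component `i`. -/
def x (i : I) : PowerSeries ℂ := PowerSeries.X ^ 2 + PowerSeries.C (S.α i)

/-- `y` on the component `i`. -/
def y (i : I) : PowerSeries ℂ := PowerSeries.mk (S.h i)

/-- Restriction of all the data along a map of index sets. -/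
def comap {J : Type*} (f : J → I) : Curve J where
  α i := S.α (f i)
  h i := S.h (f i)
  τ i := S.τ (f i)
  c i j := S.c (f i) (f j)
  jump i j := S.jump (f i) (f j)
  c_symm _ _ := S.c_symm _ _
  jump_symm _ _ := S.jump_symm _ _

/-- The coefficient of `ζₐ^m dζₐ`, where `e = (a, m)`, in `B(ζₐ, ζᵢ) / dζᵢ = B(ζᵢ, ζₐ) / dζᵢ`, as a
power series in `ζᵢ`.  As always under a residue at `ζᵢ → 0`, the expansion is for `ζᵢ` small
compared to `ζₐ`, so that
`dtₐ dtᵢ / (tₐ - tᵢ)² = ∑ₖ (k + 1) (τₐ / τᵢ)^(k+1) ζₐ^(-k-2) ζᵢ^k dζₐ dζᵢ`. -/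
def bSeries (e : I × ℤ) (i : I) : PowerSeries ℂ :=
  PowerSeries.mk fun k =>
    (if e.2 = -(k : ℤ) - 2 then S.c e.1 i * (k + 1) * ((S.τ e.1 : ℂ) / S.τ i) ^ (k + 1) else 0) +
    (if 0 ≤ e.2 then S.jump e.1 i e.2.toNat k else 0)

/-- `B(ζᵢ, -ζᵢ) / (dζᵢ)²`; the polar part is `dt d(-t) / (t - (-t))² = -(dζ)² / (4 ζ²)`. -/
def bDiag (i : I) : LaurentSeries ℂ :=
  HahnSeries.single (-2) (-(S.c i i) / 4) +
  HahnSeries.ofPowerSeries ℤ ℂ (PowerSeries.mk fun m =>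
    ∑ p ∈ Finset.HasAntidiagonal.antidiagonal m, (-1) ^ (p.2 + 1) * S.jump i i p.1 p.2)

/-- The recursion kernel `K(ζ₀, ζᵢ) = ½ ∫_{-ζᵢ}^{ζᵢ} B(ζ₀, ·) / ((y(ζᵢ) - y(-ζᵢ)) dx(ζᵢ))`:
the coefficient of `ζₐ^m dζₐ`, where `e = (a, m)` and `ζ₀` lies in the component `a`, as a Laurent
series in `ζᵢ` (to be multiplied by `1 / dζᵢ`). -/
def kernel (e : I × ℤ) (i : I) : LaurentSeries ℂ :=
  HahnSeries.ofPowerSeries ℤ ℂ (PowerSeries.C (1 / 2) * symIntegral (S.bSeries e i)) /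
  HahnSeries.ofPowerSeries ℤ ℂ
    ((S.y i - PowerSeries.rescale (-1) (S.y i)) * PowerSeries.derivative ℂ (S.x i))

variable (ω : ∀ (_ n : ℕ), MultiDiff I (n + 1))

/-- `ω_{g,1+n}(ζᵢ, ζ₁, …, ζₙ) / dζᵢ`, the part with monomial `v` in `ζ₁, …, ζₙ`, when `ω g n` is
the stable `ω_{g,n+1}`.  Here `ω_{0,2} = B`, and `ω_{0,1}` is left out of the recursion. -/
def leg : (g n : ℕ) → I → (Fin n → I × ℤ) → LaurentSeries ℂ
  | 0, 0, _, _ => 0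
  | 0, 1, i, v => HahnSeries.ofPowerSeries ℤ ℂ (S.bSeries (v 0) i)
  | 0, n + 2, i, v => (ω 0 (n + 2)).series i v
  | g + 1, n, i, v => (ω (g + 1) n).series i v

/-- `ω_{g-1,n+2}(ζᵢ, -ζᵢ, ζ₁, …, ζₙ) / (dζᵢ)²`, the part with monomial `v` in `ζ₁, …, ζₙ`. -/
def loop : (g n : ℕ) → I → (Fin n → I × ℤ) → LaurentSeries ℂ
  | 0, _, _, _ => 0
  | 1, 0, i, _ => S.bDiag i
  | 1, n + 1, i, v => (ω 0 (n + 2)).diag i v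
  | g + 2, n, i, v => (ω (g + 1) (n + 1)).diag i v

/-- The bracket of the recursion, divided by `(dζᵢ)²`:
`ω_{g-1,n+2}(ζᵢ, -ζᵢ, ζ₁, …, ζₙ) + ∑ ω_{g₁,1+|J|}(ζᵢ, ζ_J) ω_{g₂,1+|Jᶜ|}(-ζᵢ, ζ_{Jᶜ})`
over `g₁ + g₂ = g` and `J ⊆ {1, …, n}`. -/
def bracket (g n : ℕ) (i : I) (v : Fin n → I × ℤ) : LaurentSeries ℂ :=
  S.loop ω g n i v +
  ∑ p ∈ Finset.HasAntidiagonal.antidiagonal g, ∑ J : Finset (Fin n),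
    S.leg ω p.1 J.card i (v ∘ J.orderEmbOfFin rfl) *
      -negArg (S.leg ω p.2 Jᶜ.card i (v ∘ Jᶜ.orderEmbOfFin rfl))

theorem bSeries_coeff_eq_zero {e : I × ℤ} {i : I} {N k : ℕ} (he : e.2 < -(N : ℤ) - 2)
    (hk : k ≤ N) : PowerSeries.coeff k (S.bSeries e i) = 0 := by
  rw [bSeries, PowerSeries.coeff_mk, if_neg (by omega), if_neg (by omega), add_zero]

theorem tame_bSeries (i : I) : Tame (fun v : Fin 1 → I × ℤ =>
    HahnSeries.ofPowerSeries ℤ ℂ (S.bSeries (v 0) i)) := by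
  refine ⟨⟨0, fun v => vanishBelow_ofPowerSeries (N := 0) (by simp)⟩,
    fun M => ⟨-(M.toNat : ℤ) - 2, fun v ⟨j, hj⟩ => ?_⟩⟩
  refine (vanishBelow_ofPowerSeries (N := M.toNat) fun k hk => ?_).mono (by omega)
  obtain rfl : j = 0 := Subsingleton.elim _ _
  exact S.bSeries_coeff_eq_zero hj hk.le

theorem tame_kernel (i : I) : Tame (fun v : Fin 1 → I × ℤ => S.kernel (v 0) i) := by
  have h : Tame (fun v : Fin 1 → I × ℤ => HahnSeries.ofPowerSeries ℤ ℂ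
      (PowerSeries.C (1 / 2) * symIntegral (S.bSeries (v 0) i))) := by
    refine ⟨⟨0, fun v => vanishBelow_ofPowerSeries (N := 0) (by simp)⟩,
      fun M => ⟨-(M.toNat : ℤ) - 2, fun v ⟨j, hj⟩ => ?_⟩⟩
    refine (vanishBelow_ofPowerSeries (N := M.toNat) fun k hk => ?_).mono (by omega)
    obtain rfl : j = 0 := Subsingleton.elim _ _
    have := S.bSeries_coeff_eq_zero (i := i) hj (k := k - 1) (by omega)
    simp [symIntegral, PowerSeries.coeff_C_mul, PowerSeries.coeff_rescale, this]
  have h' := h.mul (Tame.const (I := I) (HahnSeries.ofPowerSeries ℤ ℂ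
    ((S.y i - PowerSeries.rescale (-1) (S.y i)) * PowerSeries.derivative ℂ (S.x i)))⁻¹)
    id Fin.elim0 (fun j => Or.inl ⟨j, rfl⟩)
  simpa only [kernel, div_eq_mul_inv, Function.comp_id] using h'

theorem tame_leg (g n : ℕ) (i : I) : Tame (S.leg ω g n i) := by
  match g, n with
  | 0, 0 => exact Tame.zero
  | 0, 1 => exact S.tame_bSeries i
  | 0, n + 2 => exact Tame.series _ i
  | g + 1, n => exact Tame.series _ i

theorem tame_loop (g n : ℕ) (i : I) : Tame (S.loop ω g n i) := by
  match g, n with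
  | 0, _ => exact Tame.zero
  | 1, 0 => exact Tame.const _
  | 1, n + 1 => exact Tame.diag _ i
  | g + 2, n => exact Tame.diag _ i

theorem tame_bracket (g n : ℕ) (i : I) : Tame (S.bracket ω g n i) := by
  refine (S.tame_loop ω g n i).add (Tame.sum _ fun p => Tame.sum _ fun J => ?_)
  refine (S.tame_leg ω p.1 J.card i).mul (S.tame_leg ω p.2 Jᶜ.card i).negArg.neg
    (J.orderEmbOfFin rfl) (Jᶜ.orderEmbOfFin rfl) fun j => ?_
  have key (K : Finset (Fin n)) (hj : j ∈ K) : ∃ a, K.orderEmbOfFin rfl a = j := by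
    rw [← Set.mem_range, Finset.range_orderEmbOfFin]
    exact hj
  by_cases hj : j ∈ J
  · exact Or.inl (key J hj)
  · exact Or.inr (key Jᶜ (by simpa using hj))

theorem bracket_congr {ω ω' : ∀ (_ n : ℕ), MultiDiff I (n + 1)} {g n : ℕ}
    (h : ∀ g' n', 2 * g' + n' < 2 * g + n → ω g' n' = ω' g' n') (i : I) (v : Fin n → I × ℤ) :
    S.bracket ω g n i v = S.bracket ω' g n i v := by
  have hleg (g' m : ℕ) (hm : 2 * g' + m < 2 * g + n) (w) :
      S.leg ω g' m i w = S.leg ω' g' m i w := by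
    match g', m with
    | 0, 0 => rfl
    | 0, 1 => rfl
    | 0, m + 2 => simp only [leg, h _ _ hm]
    | g' + 1, m => simp only [leg, h _ _ hm]
  unfold bracket
  congr 1
  · match g, n with
    | 0, _ => rfl
    | 1, 0 => rfl
    | 1, n + 1 => simp only [loop, h 0 (n + 2) (by omega)]
    | g + 2, n => simp only [loop, h (g + 1) (n + 1) (by omega)]
  · refine Finset.sum_congr rfl fun p hp => Finset.sum_congr rfl fun J _ => ?_
    rw [Finset.HasAntidiagonal.mem_antidiagonal] at hp
    have hJ : J.card + Jᶜ.card = n := by simp [J.card_add_card_compl]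
    generalize hw : v ∘ J.orderEmbOfFin rfl = w
    generalize hw' : v ∘ Jᶜ.orderEmbOfFin rfl = w'
    clear hw hw'
    generalize J.card = a at *
    generalize Jᶜ.card = b at *
    obtain ⟨p, q⟩ := p
    dsimp only at *
    by_cases h1 : 2 * p + a = 0
    · obtain rfl : p = 0 := by omega
      obtain rfl : a = 0 := by omega
      simp [leg]
    by_cases h2 : 2 * q + b = 0
    · obtain rfl : q = 0 := by omega
      obtain rfl : b = 0 := by omega
      have hz : negArg 0 = 0 := by ext; simp [negArg]
      simp [leg, hz]
    rw [hleg p a (by omega), hleg q b (by omega)]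

variable [Fintype I]

/-- The right-hand side of the topological recursion,
`∑ᵢ Res_{ζᵢ → 0} K(ζ₀, ζᵢ) (⋯)`, as an `(n + 1)`-differential in `ζ₀, …, ζₙ`. -/
def step (g n : ℕ) : MultiDiff I (n + 1) where
  coeff v := ∑ i, (S.kernel (v 0) i * S.bracket ω g n i (Fin.tail v)).coeff (-1)
  bdd := by
    have h : Tame (fun v : Fin (n + 1) → I × ℤ =>
        ∑ i, S.kernel (v 0) i * S.bracket ω g n i (Fin.tail v)) :=
      Tame.sum _ fun i => (S.tame_kernel i).mul (S.tame_bracket ω g n i) (fun _ => 0) Fin.succ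
        (Fin.cases (Or.inl ⟨0, rfl⟩) fun j => Or.inr ⟨j, rfl⟩)
    obtain ⟨N, hN⟩ := h.escape 0
    refine ⟨N, fun v hv => ?_⟩
    have := hN v hv (-1) (by norm_num)
    simpa [HahnSeries.coeff_sum] using this

/-- The correlator `ω_{g,n+1}`, for `2g - 2 + (n + 1) > 0`, by recursion on `2g - 2 + (n + 1)`.
(In the unstable cases the value is irrelevant; see `correlator_eq`.) -/
def correlator (g n : ℕ) : MultiDiff I (n + 1) :=
  S.step (fun g' n' => if _h : 2 * g' + n' < 2 * g + n then correlator g' n' else 0) g n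
termination_by 2 * g + n

/-- The topological recursion. -/
theorem correlator_eq (g n : ℕ) : S.correlator g n = S.step S.correlator g n := by
  rw [correlator]
  ext v
  refine Finset.sum_congr rfl fun i _ => ?_
  rw [S.bracket_congr (ω' := S.correlator) (fun g' n' h => by rw [dif_pos h])]

end Curve

/-! ### Equivariant curves -/

/-- A local `G`-equivariant spectral curve with index set `I`. -/
structure EquivariantCurve (G I : Type*) [Group G] [MulAction G I] where
  /-- The action of `G` on `I` is free. -/
  free : ∀ (γ : G) (i : I), γ • i = i → γ = 1
  /-- A system of representatives of the orbits. -/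
  reps : Finset I
  existsUnique_rep : ∀ i : I, ∃! r : I, r ∈ reps ∧ r ∈ MulAction.orbit G i
  χ : G →* ℂˣ
  υ : G →* ℂˣ
  β : G →* ℂˣ
  β_sq : ∀ γ, β γ ^ 2 = 1
  /-- A square root of `χ` (as a function, not necessarily a character). -/
  sqrtχ : G → ℂˣ
  sqrtχ_sq : ∀ γ, sqrtχ γ ^ 2 = χ γ
  sqrtχ_one : sqrtχ 1 = 1
  α : I → ℂ
  h : I → ℕ → ℂ
  jump : I → I → ℕ → ℕ → ℂ
  /-- `y(ζᵢ) - y(-ζᵢ)`, which occurs in the denominator of the recursion kernel, is not zero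
  (this holds in particular when `dy` does not vanish at `ζᵢ = 0`). -/
  y_not_even : ∀ i, ∃ k, Odd k ∧ h i k ≠ 0
  h_smul : ∀ (γ : G), ∀ i ∈ reps, ∀ k : ℕ,
    h (γ • i) k = υ γ * (sqrtχ γ : ℂ) ^ (-(k : ℤ)) * h i k
  jump_symm : ∀ i j k l, jump i j k l = jump j i l k
  jump_smul : ∀ (γ η : G), ∀ i ∈ reps, ∀ j ∈ reps, ∀ k l : ℕ,
    jump (γ • i) (η • j) k l =
      β (γ * η) * (sqrtχ γ : ℂ) ^ (-(k : ℤ) - 1) * (sqrtχ η : ℂ) ^ (-(l : ℤ) - 1) * jump i j k l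

namespace EquivariantCurve

variable {G I : Type*} [Group G] [MulAction G I] (S : EquivariantCurve G I)

theorem exists_decomp (i : I) : ∃ p : G × S.reps, p.1 • (p.2 : I) = i := by
  obtain ⟨r, ⟨hr, γ, rfl⟩, -⟩ := S.existsUnique_rep i
  exact ⟨(γ⁻¹, ⟨_, hr⟩), by simp⟩

/-- The unique `γ` with `i = γ r`, `r` a representative. -/
def grp (i : I) : G := (S.exists_decomp i).choose.1

/-- The unique representative `r` in the orbit of `i`. -/
def rep (i : I) : S.reps := (S.exists_decomp i).choose.2

theorem grp_smul_rep (i : I) : S.grp i • (S.rep i : I) = i := (S.exists_decomp i).choose_spec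

/-- The extension of a multidifferential on the quotient curve to all components by
`ω(…, ζ_{γ r}, …) = β_γ ω(…, ζ_r, …)` in each variable, for `r` a representative and
`ζ_{γ r} = √χ_γ ζ_r`. -/
def extend {n : ℕ} (ω : MultiDiff S.reps n) : MultiDiff I n where
  coeff v := (∏ j, (S.β (S.grp (v j).1) : ℂ) * (S.sqrtχ (S.grp (v j).1) : ℂ) ^ (-(v j).2 - 1)) *
    ω.coeff fun j => (S.rep (v j).1, (v j).2)
  bdd := by
    obtain ⟨N, hN⟩ := ω.bdd
    exact ⟨N, fun v hv => by rw [hN _ hv, mul_zero]⟩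

variable [Fintype G]

open Classical in
/-- The biresidues `(∑_γ β_γ δ_{i,γj}) / |G|` of `B`. -/
def biresidue (i j : I) : ℂ :=
  (∑ γ : G, if i = γ • j then (S.β γ : ℂ) else 0) / Fintype.card G

theorem biresidue_symm (i j : I) : S.biresidue i j = S.biresidue j i := by
  unfold biresidue
  congr 1
  refine Fintype.sum_equiv (Equiv.inv G) _ _ fun γ => ?_
  have h1 : S.β γ⁻¹ = S.β γ := by
    rw [map_inv, inv_eq_iff_mul_eq_one, ← sq, S.β_sq]
  have h2 : i = γ • j ↔ j = γ⁻¹ • i := by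
    rw [eq_inv_smul_iff, eq_comm]
  rw [Equiv.inv_apply, h1]
  by_cases h : i = γ • j
  · rw [if_pos h, if_pos (h2.1 h)]
  · rw [if_neg h, if_neg (mt h2.2 h)]

/-- The underlying curve.  For `i = γ r` with `r` a representative, `ζᵢ / √χ_γ` corresponds to `ζᵣ`
under the action of `γ`, so that the poles of a `B` which is equivariant are along
`ζᵢ / √χ_γ = ζⱼ / √χ_η`, for `i = γ r` and `j = η r`. -/
def toCurve : Curve I where
  α := S.α
  h := S.h
  τ i := S.sqrtχ (S.grp i)
  c := S.biresidue
  jump := S.jump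
  c_symm := S.biresidue_symm
  jump_symm := S.jump_symm

/-- The quotient (or reduced) curve: the restriction of `x`, `y` and `B` to the components whose
index is a representative. -/
def reduced : Curve S.reps := S.toCurve.comap Subtype.val

end EquivariantCurve

end

end LocalTR

namespace LocalTR

noncomputable section

/-! Compare the residue at the component `γ r` with the one at its representative `r`. Every
ingredient of the recursion at `γ r` is a constant times the reduced ingredient at `r`, after the
substitution `ζ ↦ ζ / √χ_γ`. Since `scale` is a ring homomorphism, this passes through the products
and the quotient. Up to the weights of the outer variables, the kernel contributes `β_γ / (υ_γ
√χ_γ)` (`kernel_eq`), the bracket `√χ_γ⁻²` (`bracket_eq`) and the residue `√χ_γ`. Together they give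
`β_γ / (χ_γ υ_γ)`. Only `√χ_γ² = χ_γ` enters, so `√χ` need not be multiplicative. Thus the sum over
each orbit is the reduced residue times `∑_γ β_γ / (χ_γ υ_γ)`, the scalar `charSum`. Induction on
`2g + n` (`correlator_coeff`) gives one such factor per unit of `2g - 2 + (n + 1)`, starting from
`ω_{0,2} = B` with none. Orthogonality of characters makes the scalar `|G|` or `0`, which settles
both cases at once. -/

/-! ### Rescaling of Laurent and power series -/

/-- The substitution `f(ζ) ↦ f(ζ / u)` on Laurent series. -/
def scale (u : ℂˣ) : LaurentSeries ℂ →+* LaurentSeries ℂ where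
  toFun f :=
    { coeff := fun p => (u : ℂ) ^ (-p) * f.coeff p
      isPWO_support' := f.isPWO_support.mono fun p hp h => hp (by simp [h]) }
  map_one' := by
    ext p
    by_cases hp : p = 0 <;> simp [HahnSeries.coeff_one, hp]
  map_zero' := by ext p; simp
  map_add' f g := by ext p; simp [mul_add]
  map_mul' f g := by
    ext p
    simp only [HahnSeries.coeff_mul, Finset.mul_sum]
    refine Finset.sum_congr ?_ fun x hx => ?_
    · ext x
      simp [Finset.mem_antidiagonal, HahnSeries.mem_support, zpow_ne_zero]
    · rw [Finset.mem_antidiagonal] at hx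
      have hx : x.1 + x.2 = p := by simpa using hx.2.2
      rw [← hx, neg_add, zpow_add₀ u.ne_zero]
      ring

@[simp]
theorem coeff_scale (u : ℂˣ) (f : LaurentSeries ℂ) (p : ℤ) :
    (scale u f).coeff p = (u : ℂ) ^ (-p) * f.coeff p := rfl

@[simp]
theorem coeff_negArg (f : LaurentSeries ℂ) (p : ℤ) :
    (negArg f).coeff p = (-1) ^ p * f.coeff p := rfl

theorem negArg_smul_scale (a : ℂ) (u : ℂˣ) (f : LaurentSeries ℂ) :
    negArg (a • scale u f) = a • scale u (negArg f) := by
  ext p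
  simp only [coeff_negArg, coeff_scale, HahnSeries.coeff_smul, smul_eq_mul]
  ring

theorem smul_scale_mul (a b : ℂ) (u : ℂˣ) (f f' : LaurentSeries ℂ) :
    (a • scale u f) * (b • scale u f') = (a * b) • scale u (f * f') := by
  simp only [← HahnSeries.C_mul_eq_smul, map_mul]
  ring

theorem neg_smul_scale (a : ℂ) (u : ℂˣ) (f : LaurentSeries ℂ) :
    -(a • scale u f) = a • scale u (-f) := by
  ext p
  simp only [coeff_scale, HahnSeries.coeff_smul, HahnSeries.coeff_neg, smul_eq_mul, mul_neg]

theorem ofPowerSeries_eq_smul_scale {f f' : PowerSeries ℂ} {a : ℂ} {u : ℂˣ}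
    (h : ∀ k : ℕ, PowerSeries.coeff k f = a * (u : ℂ) ^ (-(k : ℤ)) * PowerSeries.coeff k f') :
    HahnSeries.ofPowerSeries ℤ ℂ f = a • scale u (HahnSeries.ofPowerSeries ℤ ℂ f') := by
  ext p
  rw [HahnSeries.coeff_smul, coeff_scale, smul_eq_mul]
  rcases lt_or_ge p 0 with hp | hp
  · have hz (q : PowerSeries ℂ) : (HahnSeries.ofPowerSeries ℤ ℂ q).coeff p = 0 :=
      vanishBelow_ofPowerSeries (N := 0) (by simp) p (by simpa using hp)
    rw [hz, hz, mul_zero, mul_zero]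
  · lift p to ℕ using hp
    rw [HahnSeries.ofPowerSeries_apply_coeff, HahnSeries.ofPowerSeries_apply_coeff, h, mul_assoc]

/-- Integration raises the degree by one, which absorbs the shift `-1` that came from the
differential `dζ`. -/
theorem coeff_symIntegral_eq {f f' : PowerSeries ℂ} {a : ℂ} {u : ℂˣ}
    (h : ∀ k : ℕ, PowerSeries.coeff k f = a * (u : ℂ) ^ (-(k : ℤ) - 1) * PowerSeries.coeff k f')
    (k : ℕ) : PowerSeries.coeff k (symIntegral f) =
      a * (u : ℂ) ^ (-(k : ℤ)) * PowerSeries.coeff k (symIntegral f') := by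
  rcases k with _ | k
  · simp only [symIntegral, map_sub, PowerSeries.coeff_rescale, PowerSeries.coeff_mk, if_true,
      mul_zero, sub_zero]
  · simp only [symIntegral, map_sub, PowerSeries.coeff_rescale, PowerSeries.coeff_mk,
      Nat.add_one_ne_zero, if_false, Nat.add_sub_cancel, h]
    rw [show -((k + 1 : ℕ) : ℤ) = -(k : ℤ) - 1 by push_cast; ring]
    ring

/-- A product over a finite set `J` and its complement, both enumerated in increasing order. -/
theorem prod_orderEmbOfFin_mul_prod_compl {n : ℕ} (J : Finset (Fin n)) (f : Fin n → ℂ) :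
    (∏ a, f (J.orderEmbOfFin rfl a)) * ∏ a, f (Jᶜ.orderEmbOfFin rfl a) = ∏ j, f j := by
  have key (K : Finset (Fin n)) : ∏ a, f (K.orderEmbOfFin rfl a) = ∏ j ∈ K, f j := by
    conv_rhs => rw [← Finset.map_orderEmbOfFin_univ K rfl, Finset.prod_map]
    rfl
  rw [key, key, Finset.prod_mul_prod_compl]

theorem Curve.derivative_x {I : Type*} (S : Curve I) (i : I) :
    PowerSeries.derivative ℂ (S.x i) = PowerSeries.C 2 * PowerSeries.X := by
  ext k
  rw [PowerSeries.coeff_derivative, Curve.x, map_add, PowerSeries.coeff_X_pow,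
    PowerSeries.coeff_C, PowerSeries.coeff_C_mul, PowerSeries.coeff_X]
  by_cases hk : k = 1 <;> simp [hk]
  norm_num

/-! ### Orbit decomposition of the index set -/

namespace EquivariantCurve

variable {G I : Type*} [Group G] [MulAction G I] (S : EquivariantCurve G I)

theorem rep_smul (γ : G) (r : S.reps) : S.rep (γ • (r : I)) = r := by
  obtain ⟨s, -, hs⟩ := S.existsUnique_rep (γ • (r : I))
  have h1 := hs r ⟨r.2, γ⁻¹, by simp⟩
  have h2 := hs (S.rep (γ • (r : I)))
    ⟨(S.rep _).2, (S.grp (γ • (r : I)))⁻¹, by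
      simp only [inv_smul_eq_iff, S.grp_smul_rep]⟩
  exact Subtype.ext (h2.trans h1.symm)

/-- Freeness of the action makes the chosen group element the only possible one. -/
theorem grp_smul (γ : G) (r : S.reps) : S.grp (γ • (r : I)) = γ := by
  have h := S.grp_smul_rep (γ • (r : I))
  rw [rep_smul] at h
  have h' := S.free (γ⁻¹ * S.grp (γ • (r : I))) r (by rw [mul_smul, h, inv_smul_smul])
  exact (inv_mul_eq_one.1 h').symm

/-- The index set is the product of the group and the set of representatives. -/
def decomp : I ≃ G × S.reps where
  toFun i := (S.grp i, S.rep i)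
  invFun p := p.1 • (p.2 : I)
  left_inv := S.grp_smul_rep
  right_inv _ := Prod.ext (S.grp_smul _ _) (S.rep_smul _ _)

theorem grp_rep (r : S.reps) : S.grp (r : I) = 1 := by
  simpa using S.grp_smul 1 r

/-- `√χ_γ` for the index `i = γ r`. -/
def root (i : I) : ℂˣ := S.sqrtχ (S.grp i)

/-- `β_γ` for the index `i = γ r`. -/
def sign (i : I) : ℂ := S.β (S.grp i)

theorem root_rep (r : S.reps) : S.root (r : I) = 1 := by
  rw [root, grp_rep, sqrtχ_one]

theorem β_mul_self (γ : G) : (S.β γ : ℂ) * S.β γ = 1 := by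
  have := S.β_sq γ
  rw [sq] at this
  rw [← Units.val_mul, this, Units.val_one]

theorem sign_mul_self (i : I) : S.sign i * S.sign i = 1 := S.β_mul_self _

/-! ### Weights of monomials and the equivariance of the data -/

/-- The index of the quotient curve under the index `e` of a monomial. -/
def down (e : I × ℤ) : S.reps × ℤ := (S.rep e.1, e.2)

/-- The factor relating the coefficient of `ζᵢᵐ dζᵢ` to that on the representative of `i`. -/
def weight (e : I × ℤ) : ℂ := S.sign e.1 * (S.root e.1 : ℂ) ^ (-e.2 - 1)

/-- The product of the weights of all variables. -/
def totalWeight {n : ℕ} (v : Fin n → I × ℤ) : ℂ := ∏ j, S.weight (v j)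

theorem extend_coeff {n : ℕ} (ω : MultiDiff S.reps n) (v : Fin n → I × ℤ) :
    (S.extend ω).coeff v = S.totalWeight v * ω.coeff (S.down ∘ v) := rfl

theorem totalWeight_cons {n : ℕ} (e : I × ℤ) (v : Fin n → I × ℤ) :
    S.totalWeight (Fin.cons e v : Fin (n + 1) → I × ℤ) = S.weight e * S.totalWeight v := by
  simp [totalWeight, Fin.prod_univ_succ]

theorem down_comp_cons {n : ℕ} (e : I × ℤ) (v : Fin n → I × ℤ) :
    S.down ∘ (Fin.cons e v : Fin (n + 1) → I × ℤ) =
      (Fin.cons (S.down e) (S.down ∘ v) : Fin (n + 1) → S.reps × ℤ) := by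
  funext j
  refine Fin.cases ?_ (fun j => ?_) j <;> simp

theorem h_eq (i : I) (k : ℕ) :
    S.h i k = S.υ (S.grp i) * (S.root i : ℂ) ^ (-(k : ℤ)) * S.h (S.rep i) k := by
  conv_lhs => rw [← S.grp_smul_rep i]
  exact S.h_smul _ _ (S.rep i).2 k

theorem jump_eq (i j : I) (k l : ℕ) :
    S.jump i j k l = S.sign i * S.sign j * (S.root i : ℂ) ^ (-(k : ℤ) - 1) *
      (S.root j : ℂ) ^ (-(l : ℤ) - 1) * S.jump (S.rep i) (S.rep j) k l := by
  conv_lhs => rw [← S.grp_smul_rep i, ← S.grp_smul_rep j]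
  rw [S.jump_smul _ _ _ (S.rep i).2 _ (S.rep j).2 k l, map_mul, Units.val_mul]
  rfl

/-- The weight of the first variable splits into `(root i)⁻ᵖ`, which is the rescaling, and a
constant coming from `β` and `dζᵢ`. -/
theorem series_eq {n : ℕ} {a : ℂ} {η : MultiDiff I (n + 1)} {η' : MultiDiff S.reps (n + 1)}
    (h : ∀ v, η.coeff v = a * (S.extend η').coeff v) (i : I) (v : Fin n → I × ℤ) :
    η.series i v = (a * S.totalWeight v * (S.sign i * (S.root i : ℂ)⁻¹)) •
      scale (S.root i) (η'.series (S.rep i) (S.down ∘ v)) := by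
  ext p
  rw [HahnSeries.coeff_smul, coeff_scale, smul_eq_mul]
  change η.coeff _ = _ * (_ * η'.coeff _)
  rw [h, extend_coeff, totalWeight_cons, down_comp_cons, weight, zpow_sub_one₀ (Units.ne_zero _)]
  simp only [down]
  ring

/-- Both of the first two variables lie on the component `i`, so their signs cancel because `β² =
1`. The powers of the root depend only on the total degree `m` and leave `(root i)⁻²` from `(dζᵢ)²`.
-/
theorem diag_eq {n : ℕ} {a : ℂ} {η : MultiDiff I (n + 2)} {η' : MultiDiff S.reps (n + 2)}
    (h : ∀ v, η.coeff v = a * (S.extend η').coeff v) (i : I) (v : Fin n → I × ℤ) :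
    η.diag i v = (a * S.totalWeight v * (S.root i : ℂ)⁻¹ ^ 2) •
      scale (S.root i) (η'.diag (S.rep i) (S.down ∘ v)) := by
  ext m
  rw [HahnSeries.coeff_smul, coeff_scale, smul_eq_mul, ← mul_assoc]
  change ∑ᶠ p : ℤ, _ * η.coeff _ = _ * ∑ᶠ p : ℤ, _ * η'.coeff _
  rw [← smul_eq_mul (_ * _), smul_finsum]
  refine finsum_congr fun p => ?_
  rw [h, extend_coeff, totalWeight_cons, totalWeight_cons, down_comp_cons, down_comp_cons, weight,
    weight, zpow_sub_one₀ (Units.ne_zero _), zpow_sub_one₀ (Units.ne_zero _), smul_eq_mul,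
    show -m = -p + -(m - p) by ring, zpow_add₀ (Units.ne_zero _)]
  simp only [down]
  linear_combination (-1) ^ (m - p + 1) * a * (S.root i : ℂ) ^ (-p) * (S.root i : ℂ)⁻¹ ^ 2 *
    (S.root i : ℂ) ^ (-(m - p)) * S.totalWeight v *
    η'.coeff (Fin.cons (S.rep i, p) (Fin.cons (S.rep i, m - p) (S.down ∘ v) :
      Fin (n + 1) → S.reps × ℤ)) * S.sign_mul_self i

/-! ### Equivariance of `B` and of the recursion kernel -/

variable [Fintype G]

/-- Reindex the group sum by `γ ↦ grp i * γ * (grp j)⁻¹`. Multiplicativity of `β` pulls out the two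
signs, as `β` is its own inverse. -/
theorem biresidue_eq (i j : I) :
    S.biresidue i j = S.sign i * S.sign j * S.biresidue (S.rep i) (S.rep j) := by
  unfold biresidue
  rw [mul_div_assoc', Finset.mul_sum]
  congr 1
  refine (Fintype.sum_equiv ((Equiv.mulLeft (S.grp i)).trans (Equiv.mulRight (S.grp j)⁻¹)) _ _
    fun γ => ?_).symm
  have h1 : (i = (S.grp i * γ * (S.grp j)⁻¹) • j) ↔ ((S.rep i : I) = γ • (S.rep j : I)) := by
    have h (i : I) : (S.grp i)⁻¹ • i = S.rep i := inv_smul_eq_iff.2 (S.grp_smul_rep i).symm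
    rw [mul_smul, mul_smul, ← inv_smul_eq_iff, h, h]
  have h2 : (S.β (S.grp j)⁻¹ : ℂ) = S.sign j := by
    rw [map_inv, Units.val_inv_eq_inv_val]
    exact (eq_inv_of_mul_eq_one_left (S.β_mul_self _)).symm
  rw [Equiv.trans_apply, Equiv.coe_mulLeft, Equiv.coe_mulRight]
  by_cases h : (S.rep i : I) = γ • (S.rep j : I)
  · rw [if_pos h, if_pos (h1.2 h), map_mul, map_mul, Units.val_mul, Units.val_mul, h2, sign]
    ring
  · rw [if_neg h, if_neg (mt h1.1 h), mul_zero]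

/-- Polar and regular parts of `B` transform alike: writing the double pole in the coordinates `t =
ζ / √χ` produces the same powers of the roots as those imposed on the regular coefficients. -/
theorem coeff_bSeries (e : I × ℤ) (i : I) (k : ℕ) :
    PowerSeries.coeff k (S.toCurve.bSeries e i) =
      S.weight e * S.sign i * (S.root i : ℂ) ^ (-(k : ℤ) - 1) *
        PowerSeries.coeff k (S.reduced.bSeries (S.down e) (S.rep i)) := by
  obtain ⟨a, m⟩ := e
  have hτ (r : S.reps) : S.reduced.τ r = 1 := S.root_rep r
  simp only [Curve.bSeries, PowerSeries.coeff_mk, hτ, down, weight]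
  change (if m = _ then S.biresidue a i * _ * ((S.root a : ℂ) / S.root i) ^ _ else 0) +
    (if 0 ≤ m then S.jump a i _ _ else 0) = _ *
    ((if m = _ then S.biresidue (S.rep a) (S.rep i) * _ * _ else 0) +
    (if 0 ≤ m then S.jump (S.rep a) (S.rep i) _ _ else 0))
  rw [mul_add (_ * _ : ℂ) (ite _ _ _)]
  congr 1
  · split_ifs with h
    -- On the polar term `m = -k - 2`, so the exponent `-m - 1` in the weight is `k + 1`, matching
    -- the power of `τₐ / τᵢ`.
    · rw [S.biresidue_eq a i, h, show -(-(k : ℤ) - 2) - 1 = ((k + 1 : ℕ) : ℤ) by push_cast; ring,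
        show -(k : ℤ) - 1 = -((k + 1 : ℕ) : ℤ) by push_cast; ring, zpow_neg, zpow_natCast,
        zpow_natCast, div_pow]
      simp
      ring
    · rw [mul_zero]
  · split_ifs with h
    · lift m to ℕ using h
      rw [S.jump_eq a i, Int.toNat_natCast]
      ring
    · rw [mul_zero]

theorem ofPowerSeries_bSeries (e : I × ℤ) (i : I) :
    HahnSeries.ofPowerSeries ℤ ℂ (S.toCurve.bSeries e i) =
      (S.weight e * S.sign i * (S.root i : ℂ)⁻¹) •
        scale (S.root i)
          (HahnSeries.ofPowerSeries ℤ ℂ (S.reduced.bSeries (S.down e) (S.rep i))) := by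
  refine ofPowerSeries_eq_smul_scale fun k => ?_
  rw [S.coeff_bSeries, sub_eq_add_neg, zpow_add₀ (Units.ne_zero _), zpow_neg_one]
  ring

/-- The integral of `B` leaves no extra power of the root. The denominator contributes `υ` from `y`
and one root from the factor `2ζ` of `dx`, since rescaling `ζ` costs a root that has to be put back.
-/
theorem kernel_eq (e : I × ℤ) (i : I) :
    S.toCurve.kernel e i =
      (S.weight e * S.sign i * ((S.υ (S.grp i) : ℂ) * S.root i)⁻¹) •
        scale (S.root i) (S.reduced.kernel (S.down e) (S.rep i)) := by
  have hnum : HahnSeries.ofPowerSeries ℤ ℂ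
      (PowerSeries.C (1 / 2) * symIntegral (S.toCurve.bSeries e i)) =
      (S.weight e * S.sign i) • scale (S.root i) (HahnSeries.ofPowerSeries ℤ ℂ
        (PowerSeries.C (1 / 2) * symIntegral (S.reduced.bSeries (S.down e) (S.rep i)))) := by
    refine ofPowerSeries_eq_smul_scale fun k => ?_
    rw [PowerSeries.coeff_C_mul, PowerSeries.coeff_C_mul,
      coeff_symIntegral_eq (S.coeff_bSeries e i)]
    ring
  have hden : HahnSeries.ofPowerSeries ℤ ℂ
      ((S.toCurve.y i - PowerSeries.rescale (-1) (S.toCurve.y i)) *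
        PowerSeries.derivative ℂ (S.toCurve.x i)) =
      ((S.υ (S.grp i) : ℂ) * S.root i) • scale (S.root i) (HahnSeries.ofPowerSeries ℤ ℂ
        ((S.reduced.y (S.rep i) - PowerSeries.rescale (-1) (S.reduced.y (S.rep i))) *
          PowerSeries.derivative ℂ (S.reduced.x (S.rep i)))) := by
    refine ofPowerSeries_eq_smul_scale fun k => ?_
    rw [Curve.derivative_x, Curve.derivative_x, ← mul_assoc, ← mul_assoc]
    rcases k with _ | k
    · simp
    · rw [PowerSeries.coeff_succ_mul_X, PowerSeries.coeff_succ_mul_X, mul_comm _ (PowerSeries.C _),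
        mul_comm _ (PowerSeries.C _), PowerSeries.coeff_C_mul, PowerSeries.coeff_C_mul, map_sub,
        map_sub, PowerSeries.coeff_rescale, PowerSeries.coeff_rescale, Curve.y, Curve.y,
        PowerSeries.coeff_mk, PowerSeries.coeff_mk]
      change 2 * (S.h i k - _ * S.h i k) = _ * (2 * (S.h (S.rep i) k - _ * S.h (S.rep i) k))
      rw [S.h_eq i k, show -((k + 1 : ℕ) : ℤ) = -(k : ℤ) - 1 by push_cast; ring,
        zpow_sub_one₀ (Units.ne_zero _)]
      field_simp
  rw [Curve.kernel, Curve.kernel, hnum, hden]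
  simp only [← HahnSeries.C_mul_eq_smul, map_mul (HahnSeries.C (Γ := ℤ)),
    map_inv₀ (HahnSeries.C (Γ := ℤ)), map_div₀ (scale _)]
  field_simp

theorem bDiag_eq (i : I) :
    S.toCurve.bDiag i = ((S.root i : ℂ)⁻¹ ^ 2) •
      scale (S.root i) (S.reduced.bDiag (S.rep i)) := by
  rw [Curve.bDiag, Curve.bDiag, map_add, smul_add]
  congr 1
  · change HahnSeries.single (-2) (-(S.biresidue i i) / 4) =
      _ • scale _ (HahnSeries.single (-2) (-(S.biresidue (S.rep i) (S.rep i)) / 4))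
    rw [S.biresidue_eq i i, sign_mul_self, one_mul]
    ext p
    rw [HahnSeries.coeff_smul, coeff_scale, smul_eq_mul]
    by_cases hp : p = -2
    · subst hp
      have := (S.root i).ne_zero
      simp only [HahnSeries.coeff_single_same, neg_neg]
      rw [show (2 : ℤ) = (2 : ℕ) from rfl, zpow_natCast]
      field_simp
    · simp [HahnSeries.coeff_single_of_ne hp]
  · refine ofPowerSeries_eq_smul_scale fun k => ?_
    rw [PowerSeries.coeff_mk, PowerSeries.coeff_mk, Finset.mul_sum]
    refine Finset.sum_congr rfl fun p hp => ?_
    rw [Finset.HasAntidiagonal.mem_antidiagonal] at hp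
    change _ * S.jump i i _ _ = _ * (_ * S.jump (S.rep i) (S.rep i) _ _)
    rw [S.jump_eq i i, sign_mul_self, ← hp, Nat.cast_add, neg_add,
      zpow_add₀ (Units.ne_zero _), zpow_sub_one₀ (Units.ne_zero _),
      zpow_sub_one₀ (Units.ne_zero _)]
    ring

/-! ### Equivariance of the bracket -/

section Recursion

variable {S} {c : ℂ} {ω : ∀ (_ n : ℕ), MultiDiff I (n + 1)}
  {ω' : ∀ (_ n : ℕ), MultiDiff S.reps (n + 1)}

/-- The comparison is assumed only for stable correlators: `ω_{0,1}` is replaced by `0`, and `B`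
satisfies it with exponent `0`. -/
theorem leg_eq {g n : ℕ} (hω : 2 ≤ 2 * g + n → ∀ v, (ω g n).coeff v =
      c ^ (2 * g + n - 1) * (S.extend (ω' g n)).coeff v) (i : I) (v : Fin n → I × ℤ) :
    S.toCurve.leg ω g n i v =
      (c ^ (2 * g + n - 1) * S.totalWeight v * (S.sign i * (S.root i : ℂ)⁻¹)) •
        scale (S.root i) (S.reduced.leg ω' g n (S.rep i) (S.down ∘ v)) := by
  match g, n with
  | 0, 0 => simp [Curve.leg]
  | 0, 1 =>
    simp only [Curve.leg, Function.comp_apply]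
    rw [S.ofPowerSeries_bSeries]
    simp [totalWeight, mul_assoc]
  | 0, n + 2 => exact S.series_eq (hω (by omega)) i v
  | g + 1, n => exact S.series_eq (hω (by omega)) i v

/-- The exponent of `c` is additive: the loop term and every product with two nonzero legs carry the
same power `2g + n - 2`. -/
theorem bracket_eq {g n : ℕ} (hω : ∀ g' n', 2 ≤ 2 * g' + n' → 2 * g' + n' < 2 * g + n →
      ∀ v, (ω g' n').coeff v = c ^ (2 * g' + n' - 1) * (S.extend (ω' g' n')).coeff v)
    (i : I) (v : Fin n → I × ℤ) :
    S.toCurve.bracket ω g n i v =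
      (c ^ (2 * g + n - 2) * S.totalWeight v * (S.root i : ℂ)⁻¹ ^ 2) •
        scale (S.root i) (S.reduced.bracket ω' g n (S.rep i) (S.down ∘ v)) := by
  rw [Curve.bracket, Curve.bracket, map_add, smul_add, map_sum, Finset.smul_sum]
  congr 1
  · match g, n with
    | 0, _ => simp [Curve.loop]
    | 1, 0 => simp [Curve.loop, S.bDiag_eq i, totalWeight]
    | 1, n + 1 =>
      rw [show 2 * 1 + (n + 1) - 2 = 2 * 0 + (n + 2) - 1 by omega]
      exact S.diag_eq (hω 0 (n + 2) (by omega) (by omega)) i v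
    | g + 2, n =>
      rw [show 2 * (g + 2) + n - 2 = 2 * (g + 1) + (n + 1) - 1 by omega]
      exact S.diag_eq (hω (g + 1) (n + 1) (by omega) (by omega)) i v
  · refine Finset.sum_congr rfl fun p hp => ?_
    rw [map_sum, Finset.smul_sum]
    refine Finset.sum_congr rfl fun J _ => ?_
    rw [Finset.HasAntidiagonal.mem_antidiagonal] at hp
    have hJ : J.card + Jᶜ.card = n := by simp [J.card_add_card_compl]
    have hw : S.totalWeight v = S.totalWeight (v ∘ J.orderEmbOfFin rfl) *
        S.totalWeight (v ∘ Jᶜ.orderEmbOfFin rfl) :=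
      (prod_orderEmbOfFin_mul_prod_compl J fun j => S.weight (v j)).symm
    rw [hw, Function.comp_assoc, Function.comp_assoc]
    generalize v ∘ J.orderEmbOfFin rfl = w
    generalize v ∘ Jᶜ.orderEmbOfFin rfl = w'
    clear hw
    generalize J.card = a at *
    generalize Jᶜ.card = b at *
    obtain ⟨p, q⟩ := p
    dsimp only at *
    have hz : negArg 0 = 0 := by ext; simp
    -- The legs `ω_{0,1}` must go first: they vanish, the truncated exponent would be wrong for
    -- them, and without them both remaining legs come strictly earlier in the induction.
    by_cases h1 : 2 * p + a = 0
    · obtain rfl : p = 0 := by omega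
      obtain rfl : a = 0 := by omega
      simp [Curve.leg]
    by_cases h2 : 2 * q + b = 0
    · obtain rfl : q = 0 := by omega
      obtain rfl : b = 0 := by omega
      simp [Curve.leg, hz]
    rw [leg_eq (fun h => hω p a h (by omega)), leg_eq (fun h => hω q b h (by omega)),
      negArg_smul_scale, neg_smul_scale, smul_scale_mul,
      show 2 * g + n - 2 = (2 * p + a - 1) + (2 * q + b - 1) by omega, pow_add]
    congr 1
    -- Each leg carries one sign of the component `i`; the two cancel.
    linear_combination c ^ (2 * p + a - 1) * c ^ (2 * q + b - 1) * S.totalWeight w *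
      S.totalWeight w' * (S.root i : ℂ)⁻¹ ^ 2 * S.sign_mul_self i

end Recursion

/-! ### The character sum and the induction -/

/-- The sum over the group of the character `β / (χ υ)`. -/
def charSum : ℂ := ∑ γ : G, ((S.β / (S.χ * S.υ)) γ : ℂ)

theorem charSum_of_eq (h : S.χ * S.υ = S.β) : S.charSum = Fintype.card G := by
  simp [charSum, h]

/-- Orthogonality: the values of a nontrivial character of a finite group sum to zero. -/
theorem charSum_of_ne (h : S.χ * S.υ ≠ S.β) : S.charSum = 0 :=
  sum_hom_units_eq_zero ((Units.coeHom ℂ).comp (S.β / (S.χ * S.υ))) fun h' =>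
    h (div_eq_one.1 (MonoidHom.ext fun γ => Units.ext (DFunLike.congr_fun h' γ))).symm

/-- Keeping the character sum as an unevaluated scalar lets a single induction cover both cases of
the theorem. -/
theorem correlator_coeff [Fintype I] (g n : ℕ) (hgn : 2 ≤ 2 * g + n) (v : Fin (n + 1) → I × ℤ) :
    (S.toCurve.correlator g n).coeff v =
      S.charSum ^ (2 * g + n - 1) * (S.extend (S.reduced.correlator g n)).coeff v := by
  induction hm : 2 * g + n using Nat.strong_induction_on generalizing g n with
  | _ m ih =>
  subst hm
  have hω (g' n' : ℕ) (h : 2 ≤ 2 * g' + n') (h' : 2 * g' + n' < 2 * g + n) (w) :=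
    ih _ h' g' n' h w rfl
  rw [Curve.correlator_eq, extend_coeff, Curve.correlator_eq]
  change ∑ i, (S.toCurve.kernel (v 0) i * S.toCurve.bracket _ g n i (Fin.tail v)).coeff (-1) =
    _ * (_ * ∑ r, (S.reduced.kernel (S.down (v 0)) r *
      S.reduced.bracket _ g n r (S.down ∘ Fin.tail v)).coeff (-1))
  have hw : S.totalWeight v = S.weight (v 0) * S.totalWeight (Fin.tail v) :=
    Fin.prod_univ_succ _
  have hterm (p : G × S.reps) :
      (S.toCurve.kernel (v 0) (S.decomp.symm p) *
        S.toCurve.bracket S.toCurve.correlator g n (S.decomp.symm p) (Fin.tail v)).coeff (-1) =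
      S.charSum ^ (2 * g + n - 2) * S.totalWeight v * ((S.β / (S.χ * S.υ)) p.1 : ℂ) *
        (S.reduced.kernel (S.down (v 0)) p.2 *
          S.reduced.bracket S.reduced.correlator g n p.2 (S.down ∘ Fin.tail v)).coeff (-1) := by
    obtain ⟨γ, r⟩ := p
    change (S.toCurve.kernel (v 0) (γ • (r : I)) *
      S.toCurve.bracket S.toCurve.correlator g n (γ • (r : I)) (Fin.tail v)).coeff (-1) = _
    -- The powers of `√χ_γ` are `-1` from the kernel, `-2` from the bracket and `+1` from the
    -- rescaled coefficient of `ζ⁻¹`; the total `-2` gives `χ_γ⁻¹`.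
    rw [S.kernel_eq, S.bracket_eq hω, smul_scale_mul, HahnSeries.coeff_smul, coeff_scale,
      smul_eq_mul, sign, root, rep_smul, grp_smul, hw, MonoidHom.div_apply, MonoidHom.mul_apply,
      ← S.sqrtχ_sq]
    simp only [Units.val_div_eq_div_val, Units.val_mul, Units.val_pow_eq_pow_val, neg_neg, zpow_one]
    have := (S.sqrtχ γ).ne_zero
    have := (S.υ γ).ne_zero
    field_simp
  rw [← S.decomp.symm.sum_comp, Finset.sum_congr rfl fun p _ => hterm p, Fintype.sum_prod_type]
  simp only [← Finset.mul_sum, ← Finset.sum_mul]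
  change _ * S.charSum * _ = _
  -- The sum over the group supplies the one factor missing from the bracket's power.
  rw [show 2 * g + n - 1 = 2 * g + n - 2 + 1 by omega, pow_succ]
  ring


end EquivariantCurve

end

end LocalTR

theorem mainTheorem7 {G I : Type*} [Group G] [Fintype G] [Fintype I] [MulAction G I]
    (S : LocalTR.EquivariantCurve G I) (g n : ℕ) (hgn : 0 < 2 * (g : ℤ) - 2 + ((n + 1 : ℕ) : ℤ)) :
    (S.χ * S.υ ≠ S.β → S.toCurve.correlator g n = 0) ∧
    (S.χ * S.υ = S.β → ∀ v : Fin (n + 1) → I × ℤ,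
      (S.toCurve.correlator g n).coeff v =
        (Fintype.card G : ℂ) ^ (2 * (g : ℤ) - 2 + ((n + 1 : ℕ) : ℤ)) *
          (S.extend (S.reduced.correlator g n)).coeff v) := by
  refine ⟨fun h => ?_, fun h v => ?_⟩
  · ext v
    -- Stability makes the exponent positive, so the power of the vanishing sum is `0` and not `1`.
    rw [S.correlator_coeff g n (by omega), S.charSum_of_ne h, zero_pow (by omega), zero_mul]
    rfl
  · rw [S.correlator_coeff g n (by omega), S.charSum_of_eq h,
      show 2 * (g : ℤ) - 2 + ((n + 1 : ℕ) : ℤ) = ((2 * g + n - 1 : ℕ) : ℤ) by omega, zpow_natCast]
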